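/- Let $N_d, Q, L, K\ge 0$ and $\delta\ge 1$ be integers, $N=N_dQ$, and let $S=[s_1^{(1)},\dots,s_1^{(Q)},\dots,s_{N_d}^{(1)},\dots,s_{N_d}^{(Q)}]\in\mathbb C^{L\times N}$ be an arbitrary (deterministic) signature matrix with nonzero columns $s_n^{(q)}$. Its coherence is $$\mu(S)=\max_{(n,q)\ne(n',q')}\frac{|\langle s_n^{(q)},s_{n'}^{(q')}\rangle|}{\|s_n^{(q)}\|_2\,\|s_{n'}^{(q')}\|_2}$$ (and $\mu(S)=0$ if $N\le 1$). Let $g_1,\dots,g_{N_d}>0$ be large-scale fading coefficients and $\sigma_w^2>0$ the noise variance. For $n\le N_d$, $l\le L$ and antennas $m=1,2,\dots$, let $h_{n,m}\sim\mathcal{CN}(0,1)$ and $w_{l,m}\sim\mathcal{CN}(0,\sigma_w^2)$ be circularly symmetric complex Gaussian random variables, all jointly independent, on a common probability space. An activity pattern is $a=(a_n^{(q)})$ with $a_n^{(q)}\in\{0,1\}$ and $\sum_q a_n^{(q)}\in\{0,1\}$ for every $n$; device $n$ is active if $\sum_q a_n^{(q)}=1$. The true parameter is $\gamma^0=(g_n^2a_n^{(q)})_{n,q}\in\mathbb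 R^N$. The signal received at the first $M$ antennas is $$Y=\sum_{n=1}^{N_d}\sum_{q=1}^{Q}a_n^{(q)}g_n\,s_n^{(q)}h_n^T+W\in\mathbb C^{L\times M},\qquad h_n=(h_{n,1},\dots,h_{n,M})^T,\quad W=(w_{l,m}),$$ and $\widehat\Sigma=\frac1M YY^H$. A covariance-based maximum-likelihood (ML) estimate $\widehat\gamma=\widehat\gamma_M$ is any minimizer of $$\log\det\Sigma(\gamma)+\operatorname{tr}\big(\Sigma(\gamma)^{-1}\widehat\Sigma\big),\qquad \Sigma(\gamma)=S\operatorname{diag}(\gamma)S^H+\sigma_w^2 I,$$ over $\gamma\in\mathbb R^N$ with $\gamma\ge0$ entrywise. Suppose $K+\delta>1$ and $$\mu(S)<\frac{1}{\sqrt{K+\delta-1}}.$$ Then, with probability exceeding $1-2^{-\delta}$, the following holds for every activity pattern with exactly $K$ active devices: ML estimates exist for every $M\ge1$, and $\widehat\gamma_M\to\gamma^0$ as $M\to\infty$ for every choice of ML estimates $\widehat\gamma_M$. -/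

import Mathlib

open MeasureTheory ProbabilityTheory Filter Topology
open scoped NNReal Matrix

namespace GrantFree

noncomputable section

/-- The coherence `max_{k ≠ l} |⟨x_k, x_l⟩| / (‖x_k‖₂ ‖x_l‖₂)` over the columns of a matrix
(equal to `0` if there are fewer than two columns). -/
def coherence {m n : Type*} [Fintype m] (X : Matrix m n ℂ) : ℝ :=
  ⨆ p : {p : n × n // p.1 ≠ p.2},
    ‖inner ℂ (WithLp.toLp 2 (X.col p.1.1)) (WithLp.toLp 2 (X.col p.1.2))‖ /
      (‖WithLp.toLp 2 (X.col p.1.1)‖ * ‖WithLp.toLp 2 (X.col p.1.2)‖)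

/-- The circularly symmetric complex Gaussian law `CN(0, v)`: real and imaginary parts are
independent, each `N(0, v / 2)`. -/
def complexGaussian (v : ℝ≥0) : Measure ℂ :=
  ((gaussianReal 0 (v / 2)).prod (gaussianReal 0 (v / 2))).map
    Complex.measurableEquivRealProd.symm

/-- `a n q ∈ {0, 1}` indicates whether device `n` transmits its `q`-th sequence; every device
transmits at most one sequence. -/
def IsIndicator {Nd Q : ℕ} (a : Fin Nd → Fin Q → ℝ) : Prop :=
  (∀ n q, a n q = 0 ∨ a n q = 1) ∧ ∀ n, (∑ q, |a n q| = 0) ∨ (∑ q, |a n q| = 1)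

/-- The set of active devices. -/
def activeDevices {Nd Q : ℕ} (a : Fin Nd → Fin Q → ℝ) : Set (Fin Nd) :=
  {n | ∑ q, |a n q| = 1}

/-- The true parameter `γ⁰`, with entries `g_n² a_n^{(q)}`. -/
def trueGamma {Nd Q : ℕ} (g : Fin Nd → ℝ) (a : Fin Nd → Fin Q → ℝ) : Fin Nd × Fin Q → ℝ :=
  fun i => g i.1 ^ 2 * a i.1 i.2

/-- The received signal at the first `M` antennas,
`Y = ∑_n ∑_q a_n^{(q)} g_n s_n^{(q)} h_nᵀ + W`. -/
def receivedSignal {L Nd Q : ℕ} (S : Matrix (Fin L) (Fin Nd × Fin Q) ℂ) (g : Fin Nd → ℝ)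
    (a : Fin Nd → Fin Q → ℝ) (h : Fin Nd → ℕ → ℂ) (w : Fin L → ℕ → ℂ) (M : ℕ) :
    Matrix (Fin L) (Fin M) ℂ :=
  Matrix.of fun l m => (∑ n, ∑ q, (a n q : ℂ) * (g n : ℂ) * S l (n, q) * h n m) + w l m

/-- The sample covariance `(1 / M) Y Yᴴ`. -/
def sampleCov {L M : ℕ} (Y : Matrix (Fin L) (Fin M) ℂ) : Matrix (Fin L) (Fin L) ℂ :=
  (1 / (M : ℂ)) • (Y * Yᴴ)

/-- The model covariance `S diag(γ) Sᴴ + σ_w² I`; here `v = σ_w²`. -/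
def modelCov {L Nd Q : ℕ} (S : Matrix (Fin L) (Fin Nd × Fin Q) ℂ) (v : ℝ≥0)
    (γ : Fin Nd × Fin Q → ℝ) : Matrix (Fin L) (Fin L) ℂ :=
  S * Matrix.diagonal (fun i => (γ i : ℂ)) * Sᴴ + ((v : ℝ) : ℂ) • 1

/-- The objective `log |Σ| + tr(Σ⁻¹ C)`, where `Σ` is the model covariance at `γ`. For `γ ≥ 0`,
`v > 0` and `C` positive semidefinite, the determinant and the trace are real. -/
def mlObjective {L Nd Q : ℕ} (S : Matrix (Fin L) (Fin Nd × Fin Q) ℂ) (v : ℝ≥0)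
    (C : Matrix (Fin L) (Fin L) ℂ) (γ : Fin Nd × Fin Q → ℝ) : ℝ :=
  Real.log (modelCov S v γ).det.re + ((modelCov S v γ)⁻¹ * C).trace.re

/-- `γ` solves the covariance-based maximum-likelihood problem: it minimizes the objective with
sample covariance `C` subject to `γ ≥ 0`. -/
def IsMLEstimate {L Nd Q : ℕ} (S : Matrix (Fin L) (Fin Nd × Fin Q) ℂ) (v : ℝ≥0)
    (C : Matrix (Fin L) (Fin L) ℂ) (γ : Fin Nd × Fin Q → ℝ) : Prop :=
  (∀ i, 0 ≤ γ i) ∧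
    ∀ γ' : Fin Nd × Fin Q → ℝ, (∀ i, 0 ≤ γ' i) → mlObjective S v C γ ≤ mlObjective S v C γ'

/-- The channel gains `h n m` (device `n`, antenna `m`) are `CN(0, 1)`, the noise entries `w l m`
are `CN(0, v)`, and all of them are jointly independent. -/
structure IsChannelModel {Ω : Type*} [MeasurableSpace Ω] (P : Measure Ω) {L Nd : ℕ} (v : ℝ≥0)
    (h : Fin Nd → ℕ → Ω → ℂ) (w : Fin L → ℕ → Ω → ℂ) : Prop where
  law_channel : ∀ n m, HasLaw (h n m) (complexGaussian 1) P
  law_noise : ∀ l m, HasLaw (w l m) (complexGaussian v) P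
  indep : iIndepFun
    (Sum.elim (fun p : Fin Nd × ℕ => h p.1 p.2) (fun p : Fin L × ℕ => w p.1 p.2)) P

end

end GrantFree

/-!
By the strong law of large numbers the sample covariance converges almost surely to
`Σ⁰ = Σ(γ⁰)`, so the likelihood objective converges to `log det Σ + tr (Σ⁻¹ Σ⁰)`. Since
`x - log x ≥ 1` for each eigenvalue `x` of `Σ⁻¹ Σ⁰`, this limit is minimal only at `Σ = Σ⁰`. The
inequality `det (1 + B) ≥ 1 + tr B` makes the objective coercive on `γ ≥ 0`: minimizers exist and
stay in a fixed box, where they can only accumulate at solutions `γ ≥ 0` of `Σ(γ) = Σ⁰`.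

Small coherence leaves `γ⁰` as the only solution. Suppose `∑ᵢ xᵢ sᵢ sᵢᴴ = 0` with unit vectors
`sᵢ` and `xᵢ ≥ 0` outside a set of `K` indices. Taking the trace, the positive and the negative
parts of `x` have the same total mass `m`; testing against `sₖ` with `xₖ < 0` gives `|xₖ| ≤ μ² m`.
Summing over the at most `K` negative entries, `m ≤ K μ² m`, hence `m = 0` as `K μ² < 1`.

The convergence of the sample covariance is one event of probability one that serves all activity
patterns at once, so the probability bound `1 - 2^(-δ)` is exceeded trivially.
-/

namespace GrantFree

section Coherence

theorem eq_zero_of_sum_mul_eq_zero {ι R : Type*} [Fintype ι] [CommRing R] [LinearOrder R]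
    [IsStrictOrderedRing R] {G : ι → ι → R} {c : R} (hc : 0 ≤ c) (hdiag : ∀ i, G i i = 1)
    (hoff : ∀ i j, i ≠ j → G i j ∈ Set.Icc 0 c) {T : Finset ι} (hT : T.card * c < 1) {x : ι → R}
    (hx : ∀ i ∉ T, 0 ≤ x i) (hsum : ∑ i, x i = 0) (hG : ∀ k, ∑ i, x i * G i k = 0) : x = 0 := by
  classical
  have hmass : ∑ i, (x i)⁺ = ∑ i, (x i)⁻ := by
    rw [← sub_eq_zero, ← Finset.sum_sub_distrib, ← hsum]
    simp only [posPart_sub_negPart]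
  set s := ∑ i, (x i)⁻
  have hs : 0 ≤ s := Finset.sum_nonneg fun i _ => negPart_nonneg (x i)
  have hneg (k : ι) : (x k)⁻ ≤ c * s := by
    rcases le_total 0 (x k) with hk | hk
    · rw [negPart_eq_zero.2 hk]
      positivity
    have hterm (i : ι) : x i * G i k ≤ c * (x i)⁺ - if i = k then (x k)⁻ else 0 := by
      split_ifs with hik
      · simp [hik, hdiag, posPart_eq_zero.2 hk, negPart_eq_neg.2 hk]
      · obtain ⟨h0, hle⟩ := hoff i k hik
        nlinarith [le_posPart (x i), posPart_nonneg (x i)]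
    have hle := Finset.sum_le_sum fun i (_ : i ∈ Finset.univ) => hterm i
    rw [hG, Finset.sum_sub_distrib, ← Finset.mul_sum, hmass, Finset.sum_ite_eq'] at hle
    simpa using hle
  have hle : s ≤ T.card * c * s :=
    calc s = ∑ i ∈ T, (x i)⁻ := (Finset.sum_subset (Finset.subset_univ T) fun i _ hi =>
            negPart_eq_zero.2 (hx i hi)).symm
      _ ≤ ∑ _i ∈ T, c * s := Finset.sum_le_sum fun i _ => hneg i
      _ = T.card * c * s := by rw [Finset.sum_const, nsmul_eq_mul, mul_assoc]
  have hs_zero : s = 0 := by nlinarith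
  have hpos (i : ι) : 0 ≤ x i :=
    negPart_eq_zero.1 ((Finset.sum_eq_zero_iff_of_nonneg fun i _ => negPart_nonneg (x i)).1
      hs_zero i (Finset.mem_univ i))
  funext i
  exact (Finset.sum_eq_zero_iff_of_nonneg fun i _ => hpos i).1 hsum i (Finset.mem_univ i)

theorem coherence_nonneg {m n : Type*} [Fintype m] (X : Matrix m n ℂ) : 0 ≤ coherence X :=
  Real.iSup_nonneg fun _ => by positivity

theorem norm_inner_col_le_coherence_mul {m n : Type*} [Fintype m] [Finite n] (X : Matrix m n ℂ)
    {i j : n} (hij : i ≠ j) :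
    ‖inner ℂ (WithLp.toLp 2 (X.col i)) (WithLp.toLp 2 (X.col j))‖ ≤
      coherence X * (‖WithLp.toLp 2 (X.col i)‖ * ‖WithLp.toLp 2 (X.col j)‖) := by
  have hsup := le_ciSup (f := fun p : {p : n × n // p.1 ≠ p.2} =>
    ‖inner ℂ (WithLp.toLp 2 (X.col p.1.1)) (WithLp.toLp 2 (X.col p.1.2))‖ /
      (‖WithLp.toLp 2 (X.col p.1.1)‖ * ‖WithLp.toLp 2 (X.col p.1.2)‖))
    (Set.finite_range _).bddAbove ⟨(i, j), hij⟩
  obtain h0 | hpos := (mul_nonneg (norm_nonneg (WithLp.toLp 2 (X.col i)))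
    (norm_nonneg (WithLp.toLp 2 (X.col j)))).eq_or_lt
  · rw [← h0, mul_zero, h0]
    exact norm_inner_le_norm _ _
  · exact (div_le_iff₀ hpos).1 hsup

section RCLike

variable {𝕜 m n : Type*} [RCLike 𝕜] [Fintype m] [Fintype n] [DecidableEq n]
  (X : Matrix m n 𝕜) (x : n → ℝ)

theorem dotProduct_mul_diagonal_mul_conjTranspose_mulVec (y : m → 𝕜) :
    star y ⬝ᵥ (X * Matrix.diagonal (fun i => (x i : 𝕜)) * Xᴴ) *ᵥ y =
      ((∑ i, x i * ‖inner 𝕜 (WithLp.toLp 2 (X.col i)) (WithLp.toLp 2 y)‖ ^ 2 : ℝ) : 𝕜) := by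
  have hinner (i : n) : (Xᴴ *ᵥ y) i = inner 𝕜 (WithLp.toLp 2 (X.col i)) (WithLp.toLp 2 y) := by
    rw [EuclideanSpace.inner_toLp_toLp, dotProduct_comm]
    rfl
  have hstar : star y ᵥ* X = star (Xᴴ *ᵥ y) := by
    rw [Matrix.star_mulVec, Matrix.conjTranspose_conjTranspose]
  rw [Matrix.mul_assoc, ← Matrix.mulVec_mulVec, ← Matrix.mulVec_mulVec, Matrix.dotProduct_mulVec,
    hstar, dotProduct]
  simp only [Matrix.mulVec_diagonal, Pi.star_apply, hinner, RCLike.star_def]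
  push_cast
  refine Finset.sum_congr rfl fun i _ => ?_
  rw [← RCLike.conj_mul]
  ring

theorem trace_mul_diagonal_mul_conjTranspose :
    (X * Matrix.diagonal (fun i => (x i : 𝕜)) * Xᴴ).trace =
      ((∑ i, x i * ‖WithLp.toLp 2 (X.col i)‖ ^ 2 : ℝ) : 𝕜) := by
  rw [Matrix.trace_mul_comm, ← Matrix.mul_assoc, Matrix.trace]
  push_cast
  refine Finset.sum_congr rfl fun i _ => ?_
  rw [Matrix.diag_apply, Matrix.mul_diagonal, mul_comm, ← inner_self_eq_norm_sq_to_K (𝕜 := 𝕜),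
    EuclideanSpace.inner_toLp_toLp, dotProduct_comm]
  rfl

end RCLike

theorem eq_zero_of_mul_diagonal_mul_conjTranspose_eq_zero {m n : Type*} [Fintype m] [Fintype n]
    [DecidableEq n] {X : Matrix m n ℂ} (hX : ∀ i, X.col i ≠ 0) {T : Finset n}
    (hT : T.card * coherence X ^ 2 < 1) {x : n → ℝ} (hx : ∀ i ∉ T, 0 ≤ x i)
    (h : X * Matrix.diagonal (fun i => (x i : ℂ)) * Xᴴ = 0) : x = 0 := by
  set u : n → EuclideanSpace ℂ m := fun i => WithLp.toLp 2 (X.col i) with hu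
  have hu0 (i : n) : 0 < ‖u i‖ := by simpa [hu] using hX i
  have htrace : ∑ i, x i * ‖u i‖ ^ 2 = 0 := by
    have htr := trace_mul_diagonal_mul_conjTranspose X x
    rw [RCLike.ofReal_eq_complex_ofReal, h, Matrix.trace_zero] at htr
    exact_mod_cast htr.symm
  have hquad (k : n) : ∑ i, x i * ‖inner ℂ (u i) (u k)‖ ^ 2 = 0 := by
    have hdot := dotProduct_mul_diagonal_mul_conjTranspose_mulVec X x (X.col k)
    rw [RCLike.ofReal_eq_complex_ofReal, h, Matrix.zero_mulVec, dotProduct_zero] at hdot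
    exact_mod_cast hdot.symm
  have hweighted : (fun i => x i * ‖u i‖ ^ 2) = 0 := by
    refine eq_zero_of_sum_mul_eq_zero
      (G := fun i k => ‖inner ℂ (u i) (u k)‖ ^ 2 / (‖u i‖ ^ 2 * ‖u k‖ ^ 2))
      (sq_nonneg (coherence X)) (fun i => ?_) (fun i j hij => ⟨by positivity, ?_⟩) hT
      (fun i hi => mul_nonneg (hx i hi) (sq_nonneg _)) htrace fun k => ?_
    · have := hu0 i
      rw [inner_self_eq_norm_sq_to_K]
      simp only [Complex.coe_algebraMap, norm_pow, Complex.norm_real, norm_norm]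
      field_simp
    · have := hu0 i
      have := hu0 j
      rw [div_le_iff₀ (by positivity), ← mul_pow, ← mul_pow]
      gcongr
      exact norm_inner_col_le_coherence_mul X hij
    · rw [← zero_div (‖u k‖ ^ 2), ← hquad k, Finset.sum_div]
      refine Finset.sum_congr rfl fun i _ => ?_
      have := hu0 i
      field_simp
  funext i
  simpa [(hu0 i).ne'] using congrFun hweighted i

end Coherence


section PosDef

open scoped ComplexOrder MatrixOrder

theorem one_add_sum_le_prod_one_add {ι R : Type*} [CommSemiring R] [PartialOrder R]
    [IsOrderedRing R] (s : Finset ι) {f : ι → R} (hf : ∀ i ∈ s, 0 ≤ f i) :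
    1 + ∑ i ∈ s, f i ≤ ∏ i ∈ s, (1 + f i) := by
  induction s using Finset.cons_induction with
  | empty => simp
  | cons i s hi ih =>
    obtain ⟨hfi, hfs⟩ := (Finset.forall_mem_cons hi _).1 hf
    rw [Finset.sum_cons, Finset.prod_cons]
    calc 1 + (f i + ∑ j ∈ s, f j)
        ≤ 1 + (f i + ∑ j ∈ s, f j) + f i * ∑ j ∈ s, f j :=
          le_add_of_nonneg_right (mul_nonneg hfi (Finset.sum_nonneg hfs))
      _ = (1 + f i) * (1 + ∑ j ∈ s, f j) := by ring
      _ ≤ (1 + f i) * ∏ j ∈ s, (1 + f j) :=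
          mul_le_mul_of_nonneg_left (ih hfs) (add_nonneg zero_le_one hfi)

variable {𝕜 n : Type*} [RCLike 𝕜] [Fintype n] [DecidableEq n] {A B C : Matrix n n 𝕜}

theorem det_one_add_eq_prod_eigenvalues (hA : A.IsHermitian) :
    (1 + A).det = ∏ i, (1 + (hA.eigenvalues i : 𝕜)) := by
  have heval : (-(1 + A)).det = ∏ i, -(1 + (hA.eigenvalues i : 𝕜)) := by
    have h := A.eval_charpoly (-1)
    rw [hA.charpoly_eq, Polynomial.eval_prod, map_neg, map_one] at h
    simp only [Polynomial.eval_sub, Polynomial.eval_X, Polynomial.eval_C] at h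
    simpa only [neg_add'] using h.symm
  rw [Matrix.det_neg, Finset.prod_neg, Finset.card_univ] at heval
  exact mul_left_cancel₀ (pow_ne_zero _ (neg_ne_zero.2 one_ne_zero)) heval

theorem one_add_trace_le_det_one_add (hB : B.PosSemidef) : 1 + B.trace ≤ (1 + B).det := by
  rw [det_one_add_eq_prod_eigenvalues hB.1, hB.1.trace_eq_sum_eigenvalues]
  exact one_add_sum_le_prod_one_add _ fun i _ => RCLike.ofReal_nonneg.2 (hB.eigenvalues_nonneg i)

theorem re_det_pos (hA : A.PosDef) : 0 < RCLike.re A.det :=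
  (RCLike.pos_iff.1 hA.det_pos).1

theorem re_det_mul (hB : B.PosDef) :
    RCLike.re (A * B).det = RCLike.re A.det * RCLike.re B.det := by
  rw [Matrix.det_mul, RCLike.mul_re, (RCLike.pos_iff.1 hB.det_pos).2, mul_zero, sub_zero]

theorem exists_eq_conjTranspose_mul_self (hA : A.PosDef) :
    ∃ R : Matrix n n 𝕜, IsUnit R ∧ A = Rᴴ * R :=
  CStarAlgebra.isStrictlyPositive_iff_eq_star_mul_self.1 hA.isStrictlyPositive

theorem trace_inv_mul_nonneg (hA : A.PosDef) (hC : C.PosSemidef) : 0 ≤ (A⁻¹ * C).trace := by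
  obtain ⟨R, -, hR⟩ := exists_eq_conjTranspose_mul_self hA.inv
  rw [hR, Matrix.mul_assoc, Matrix.trace_mul_comm]
  exact (hC.mul_mul_conjTranspose_same R).trace_nonneg

theorem eq_one_of_eigenvalues_eq_one (hA : A.IsHermitian) (h : hA.eigenvalues = 1) : A = 1 := by
  have hdiag : Matrix.diagonal (RCLike.ofReal ∘ (1 : n → ℝ)) = (1 : Matrix n n 𝕜) := by
    rw [← Matrix.diagonal_one]
    congr
    ext
    simp
  rw [hA.spectral_theorem, h, hdiag, map_one]

/-- Each eigenvalue `x` contributes `x - 1 - log x ≥ 0`, with equality only at `x = 1`. -/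
theorem eq_one_of_trace_sub_log_det_le (hB : B.PosDef)
    (h : RCLike.re B.trace - Real.log (RCLike.re B.det) ≤ Fintype.card n) : B = 1 := by
  have hpos := hB.eigenvalues_pos
  have hterm (i : n) : 0 ≤ hB.1.eigenvalues i - 1 - Real.log (hB.1.eigenvalues i) :=
    sub_nonneg.2 (Real.log_le_sub_one_of_pos (hpos i))
  rw [hB.1.trace_eq_sum_eigenvalues, hB.1.det_eq_prod_eigenvalues, ← RCLike.ofReal_sum,
    ← RCLike.ofReal_prod, RCLike.ofReal_re, RCLike.ofReal_re,
    Real.log_prod fun i _ => (hpos i).ne'] at h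
  have hsum : ∑ i, (hB.1.eigenvalues i - 1 - Real.log (hB.1.eigenvalues i)) = 0 := by
    refine le_antisymm ?_ (Finset.sum_nonneg fun i _ => hterm i)
    simp only [Finset.sum_sub_distrib, Finset.sum_const, Finset.card_univ, nsmul_eq_mul, mul_one]
    linarith
  refine eq_one_of_eigenvalues_eq_one hB.1 (funext fun i => ?_)
  by_contra hne
  have hzero := (Finset.sum_eq_zero_iff_of_nonneg fun i _ => hterm i).1 hsum i (Finset.mem_univ i)
  exact (sub_pos.2 (Real.log_lt_sub_one_of_pos (hpos i) hne)).ne' hzero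

/-- With `B = Rᴴ R`, the difference of the two sides depends only on `R A⁻¹ Rᴴ`. -/
theorem eq_of_log_det_add_trace_le (hA : A.PosDef) (hB : B.PosDef)
    (h : Real.log (RCLike.re A.det) + RCLike.re (A⁻¹ * B).trace ≤
      Real.log (RCLike.re B.det) + RCLike.re (B⁻¹ * B).trace) : A = B := by
  obtain ⟨R, hRu, hR⟩ := exists_eq_conjTranspose_mul_self hB
  have hAdet : IsUnit A.det := hA.det_pos.ne'.isUnit
  have hD : (R * A⁻¹ * Rᴴ).PosDef :=
    hA.inv.mul_mul_conjTranspose_same (Matrix.vecMul_injective_of_isUnit hRu)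
  have htrace : (R * A⁻¹ * Rᴴ).trace = (A⁻¹ * B).trace := by
    rw [hR, Matrix.mul_assoc, Matrix.trace_mul_comm, Matrix.mul_assoc]
  have hdet : (R * A⁻¹ * Rᴴ * A).det = B.det := by
    rw [Matrix.det_mul_right_comm, Matrix.nonsing_inv_mul_cancel_right _ _ hAdet,
      Matrix.det_mul_comm, ← hR]
  have hlog : Real.log (RCLike.re (R * A⁻¹ * Rᴴ).det) + Real.log (RCLike.re A.det) =
      Real.log (RCLike.re B.det) := by
    rw [← Real.log_mul (re_det_pos hD).ne' (re_det_pos hA).ne', ← re_det_mul hA, hdet]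
  have hone : R * A⁻¹ * Rᴴ = 1 := by
    refine eq_one_of_trace_sub_log_det_le hD ?_
    rw [Matrix.nonsing_inv_mul _ hB.det_pos.ne'.isUnit, Matrix.trace_one, RCLike.natCast_re] at h
    rw [htrace]
    linarith
  have hinv : A⁻¹ * B = 1 := by
    rw [hR, ← Matrix.mul_assoc]
    exact mul_eq_one_comm.1 (by rw [← Matrix.mul_assoc, hone])
  rw [← Matrix.mul_nonsing_inv_cancel_left A B hAdet, hinv, mul_one]

end PosDef


section MaximumLikelihood

open scoped ComplexOrder

theorem tendsto_of_eventually_le_of_unique_minimizer {α X R : Type*} [TopologicalSpace X]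
    [TopologicalSpace R] [Preorder R] [OrderClosedTopology R] {l : Filter α} {K : Set X}
    (hK : IsCompact K) {F : α → X → R} {f : X → R} {x : α → X} {x₀ : X}
    (hx : ∀ᶠ k in l, x k ∈ K) (hle : ∀ᶠ k in l, F k (x k) ≤ F k x₀)
    (hF₀ : Tendsto (F · x₀) l (𝓝 (f x₀)))
    (hF : ∀ y ∈ K, Tendsto (fun p : α × X => F p.1 p.2) (l ×ˢ 𝓝 y) (𝓝 (f y)))
    (hunique : ∀ y ∈ K, f y ≤ f x₀ → y = x₀) : Tendsto x l (𝓝 x₀) := by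
  refine hK.tendsto_nhds_of_unique_mapClusterPt hx fun y hy hcluster => hunique y hy ?_
  obtain ⟨U, hU, hUy⟩ := mapClusterPt_iff_ultrafilter.1 hcluster
  exact le_of_tendsto_of_tendsto ((hF y hy).comp ((tendsto_id'.2 hU).prodMk hUy))
    (hF₀.mono_left hU) (hU hle)

variable {L Nd Q : ℕ} {S : Matrix (Fin L) (Fin Nd × Fin Q) ℂ} {v : ℝ≥0}
  {γ : Fin Nd × Fin Q → ℝ} {C : Matrix (Fin L) (Fin L) ℂ}

theorem posSemidef_mul_diagonal_mul_conjTranspose {m n : Type*} [Finite m]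
    [Fintype n] [DecidableEq n] (X : Matrix m n ℂ) {x : n → ℝ} (hx : ∀ i, 0 ≤ x i) :
    (X * Matrix.diagonal (fun i => (x i : ℂ)) * Xᴴ).PosSemidef :=
  (Matrix.PosSemidef.diagonal fun i =>
    Complex.zero_le_real.2 (hx i)).mul_mul_conjTranspose_same X

theorem modelCov_posDef (hv : 0 < v) (hγ : ∀ i, 0 ≤ γ i) : (modelCov S v γ).PosDef :=
  Matrix.PosDef.posSemidef_add (posSemidef_mul_diagonal_mul_conjTranspose S hγ)
    (Matrix.PosDef.one.smul (Complex.zero_lt_real.2 hv))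

theorem sampleCov_posSemidef {M : ℕ} (Y : Matrix (Fin L) (Fin M) ℂ) : (sampleCov Y).PosSemidef :=
  (Matrix.posSemidef_self_mul_conjTranspose Y).smul (by positivity)

theorem continuous_modelCov (S : Matrix (Fin L) (Fin Nd × Fin Q) ℂ) (v : ℝ≥0) :
    Continuous (modelCov S v) := by
  unfold modelCov
  fun_prop

theorem tendsto_mlObjective (hv : 0 < v) {α : Type*} {l : Filter α}
    {C : α → Matrix (Fin L) (Fin L) ℂ} {C₀ : Matrix (Fin L) (Fin L) ℂ}
    {γ : α → Fin Nd × Fin Q → ℝ} {γ₀ : Fin Nd × Fin Q → ℝ} (hγ₀ : ∀ i, 0 ≤ γ₀ i)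
    (hC : Tendsto C l (𝓝 C₀)) (hγ : Tendsto γ l (𝓝 γ₀)) :
    Tendsto (fun k => mlObjective S v (C k) (γ k)) l (𝓝 (mlObjective S v C₀ γ₀)) := by
  have hpd : (modelCov S v γ₀).PosDef := modelCov_posDef hv hγ₀
  have hmodel : Tendsto (fun k => modelCov S v (γ k)) l (𝓝 (modelCov S v γ₀)) :=
    ((continuous_modelCov S v).tendsto γ₀).comp hγ
  have hinverse : ContinuousAt Ring.inverse (modelCov S v γ₀).det := by
    rw [Ring.inverse_eq_inv']
    exact continuousAt_inv₀ hpd.det_pos.ne'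
  have hinv : Tendsto (fun k => (modelCov S v (γ k))⁻¹) l (𝓝 (modelCov S v γ₀)⁻¹) :=
    (continuousAt_matrix_inv _ hinverse).tendsto.comp hmodel
  refine Tendsto.add (Tendsto.log ?_ (re_det_pos hpd).ne') ?_
  · exact ((Complex.continuous_re.comp continuous_id.matrix_det).tendsto _).comp hmodel
  · exact ((Complex.continuous_re.comp continuous_id.matrix_trace).tendsto _).comp (hinv.mul hC)

theorem pow_mul_one_add_sum_le_re_det_modelCov (hv : 0 < v) (hγ : ∀ i, 0 ≤ γ i) :
    (v : ℝ) ^ L * (1 + (v : ℝ)⁻¹ * ∑ i, γ i * ‖WithLp.toLp 2 (S.col i)‖ ^ 2) ≤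
      (modelCov S v γ).det.re := by
  have hv' : (v : ℂ) ≠ 0 := by exact_mod_cast hv.ne'
  set B := S * Matrix.diagonal (fun i => (γ i : ℂ)) * Sᴴ with hB
  have hscale : modelCov S v γ = ((v : ℝ) : ℂ) • (1 + ((v : ℝ) : ℂ)⁻¹ • B) := by
    rw [modelCov, smul_add, smul_inv_smul₀ hv', add_comm]
  have hpsd : (((v : ℝ) : ℂ)⁻¹ • B).PosSemidef :=
    (posSemidef_mul_diagonal_mul_conjTranspose S hγ).smul (by positivity)
  have hdet := (Complex.le_def.1 (one_add_trace_le_det_one_add hpsd)).1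
  have htrace := trace_mul_diagonal_mul_conjTranspose S γ
  rw [RCLike.ofReal_eq_complex_ofReal, ← hB] at htrace
  rw [hscale, Matrix.det_smul, Fintype.card_fin, ← Complex.ofReal_pow, Complex.re_ofReal_mul]
  rw [Matrix.trace_smul, htrace] at hdet
  gcongr
  simpa [← Complex.ofReal_pow] using hdet

theorem exists_bound_of_log_det_le (hS : ∀ i, S.col i ≠ 0) (hv : 0 < v) (c : ℝ) :
    ∃ B : Fin Nd × Fin Q → ℝ, ∀ γ : Fin Nd × Fin Q → ℝ, (∀ i, 0 ≤ γ i) →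
      Real.log (modelCov S v γ).det.re ≤ c → γ ≤ B := by
  refine ⟨fun i => v * Real.exp c / (v ^ L * ‖WithLp.toLp 2 (S.col i)‖ ^ 2), fun γ hγ hc i => ?_⟩
  have : (0 : ℝ) < v := hv
  have hcol : 0 < ‖WithLp.toLp 2 (S.col i)‖ := by simpa using hS i
  have hterm : γ i * ‖WithLp.toLp 2 (S.col i)‖ ^ 2 ≤
      ∑ j, γ j * ‖WithLp.toLp 2 (S.col j)‖ ^ 2 :=
    Finset.single_le_sum (f := fun j => γ j * ‖WithLp.toLp 2 (S.col j)‖ ^ 2)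
      (fun j _ => mul_nonneg (hγ j) (sq_nonneg _)) (Finset.mem_univ i)
  rw [le_div_iff₀ (by positivity)]
  calc γ i * (v ^ L * ‖WithLp.toLp 2 (S.col i)‖ ^ 2)
      = v * (v ^ L * ((v : ℝ)⁻¹ * (γ i * ‖WithLp.toLp 2 (S.col i)‖ ^ 2))) := by field_simp
    _ ≤ v * (v ^ L * (1 + (v : ℝ)⁻¹ * ∑ j, γ j * ‖WithLp.toLp 2 (S.col j)‖ ^ 2)) := by
        gcongr
        exact le_add_of_nonneg_of_le zero_le_one (by gcongr)
    _ ≤ v * (modelCov S v γ).det.re := by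
        gcongr
        exact pow_mul_one_add_sum_le_re_det_modelCov hv hγ
    _ ≤ v * Real.exp c := by
        gcongr
        exact (Real.log_le_iff_le_exp (re_det_pos (modelCov_posDef hv hγ))).1 hc

theorem log_det_le_mlObjective (hv : 0 < v) (hC : C.PosSemidef) (hγ : ∀ i, 0 ≤ γ i) :
    Real.log (modelCov S v γ).det.re ≤ mlObjective S v C γ :=
  le_add_of_nonneg_right (Complex.nonneg_iff.1 (trace_inv_mul_nonneg (modelCov_posDef hv hγ) hC)).1

theorem exists_isMLEstimate (hS : ∀ i, S.col i ≠ 0) (hv : 0 < v) (hC : C.PosSemidef) :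
    ∃ γ, IsMLEstimate S v C γ := by
  obtain ⟨B, hB⟩ := exists_bound_of_log_det_le hS hv (mlObjective S v C 0)
  have hsub (γ : Fin Nd × Fin Q → ℝ) (hγ : ∀ i, 0 ≤ γ i)
      (hle : mlObjective S v C γ ≤ mlObjective S v C 0) : γ ∈ Set.Icc 0 B :=
    ⟨hγ, hB γ hγ ((log_det_le_mlObjective hv hC hγ).trans hle)⟩
  have hcont : ContinuousOn (mlObjective S v C) (Set.Icc 0 B) := fun γ hγ =>
    (tendsto_mlObjective hv hγ.1 tendsto_const_nhds tendsto_id).mono_left nhdsWithin_le_nhds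
  have h0 : (0 : Fin Nd × Fin Q → ℝ) ∈ Set.Icc 0 B := hsub 0 (fun _ => le_rfl) le_rfl
  obtain ⟨γ, hγ, hmin⟩ := isCompact_Icc.exists_isMinOn ⟨0, h0⟩ hcont
  refine ⟨γ, hγ.1, fun γ' hγ' => ?_⟩
  rcases le_total (mlObjective S v C γ') (mlObjective S v C 0) with hle | hle
  · exact hmin (hsub γ' hγ' hle)
  · exact (hmin h0).trans hle

theorem modelCov_eq_of_mlObjective_le (hv : 0 < v) (hγ : ∀ i, 0 ≤ γ i)
    {γ₀ : Fin Nd × Fin Q → ℝ} (hγ₀ : ∀ i, 0 ≤ γ₀ i)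
    (h : mlObjective S v (modelCov S v γ₀) γ ≤ mlObjective S v (modelCov S v γ₀) γ₀) :
    modelCov S v γ = modelCov S v γ₀ := by
  simp only [mlObjective, ← RCLike.re_eq_complex_re] at h
  exact eq_of_log_det_add_trace_le (modelCov_posDef hv hγ) (modelCov_posDef hv hγ₀) h

theorem tendsto_of_isMLEstimate (hS : ∀ i, S.col i ≠ 0) (hv : 0 < v) {α : Type*} {l : Filter α}
    {C : α → Matrix (Fin L) (Fin L) ℂ} (hC : ∀ᶠ k in l, (C k).PosSemidef)
    {γ₀ : Fin Nd × Fin Q → ℝ} (hγ₀ : ∀ i, 0 ≤ γ₀ i) (hlim : Tendsto C l (𝓝 (modelCov S v γ₀)))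
    (hident : ∀ γ : Fin Nd × Fin Q → ℝ, (∀ i, 0 ≤ γ i) → modelCov S v γ = modelCov S v γ₀ → γ = γ₀)
    {γhat : α → Fin Nd × Fin Q → ℝ} (hML : ∀ᶠ k in l, IsMLEstimate S v (C k) (γhat k)) :
    Tendsto γhat l (𝓝 γ₀) := by
  set f := mlObjective S v (modelCov S v γ₀)
  have hobj : Tendsto (fun k => mlObjective S v (C k) γ₀) l (𝓝 (f γ₀)) :=
    tendsto_mlObjective hv hγ₀ hlim tendsto_const_nhds
  obtain ⟨B, hB⟩ := exists_bound_of_log_det_le hS hv (f γ₀ + 1)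
  refine tendsto_of_eventually_le_of_unique_minimizer (isCompact_Icc (a := 0) (b := B)) (f := f)
    (F := fun k => mlObjective S v (C k)) ?_ (hML.mono fun k hk => hk.2 γ₀ hγ₀) hobj
    (fun γ hγ => tendsto_mlObjective hv hγ.1 (hlim.comp tendsto_fst) tendsto_snd) fun γ hγ hle =>
      hident γ hγ.1 (modelCov_eq_of_mlObjective_le hv hγ.1 hγ₀ hle)
  filter_upwards [hC, hML, hobj.eventually (gt_mem_nhds (lt_add_one (f γ₀)))]
    with k hCk ⟨hpos, hmin⟩ hlt
  exact ⟨hpos, hB _ hpos (((log_det_le_mlObjective hv hCk hpos).trans (hmin γ₀ hγ₀)).trans hlt.le)⟩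

end MaximumLikelihood


section StrongLaw

variable {Ω ι 𝕜 : Type*} [MeasurableSpace Ω] {P : Measure Ω} [RCLike 𝕜]

/-- The empirical second-moment matrix `M⁻¹ ∑_{m < M} x_m x_mᴴ` of a sequence of vectors. -/
noncomputable def empiricalSecondMoment (x : ℕ → ι → 𝕜) (M : ℕ) : Matrix ι ι 𝕜 :=
  (M : ℝ)⁻¹ • ∑ m ∈ Finset.range M, Matrix.vecMulVec (x m) (star (x m))

/-- A sequence of pairwise independent, identically distributed, square-integrable random vectors
with second-moment matrix `E[x xᴴ] = R`. This is all that consistency requires of the channel and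
the noise. -/
structure IsIIDWithSecondMoment (P : Measure Ω) (x : ℕ → Ω → ι → 𝕜) (R : Matrix ι ι 𝕜) :
    Prop where
  memLp_two : ∀ i, MemLp (fun ω => x 0 ω i) 2 P
  indep : Pairwise fun m m' => IndepFun (x m) (x m') P
  identDistrib : ∀ m, IdentDistrib (x m) (x 0) P P
  integral_mul_star : ∀ i j, ∫ ω, x 0 ω i * star (x 0 ω j) ∂P = R i j

theorem IsIIDWithSecondMoment.ae_tendsto_empiricalSecondMoment [Countable ι] {x : ℕ → Ω → ι → 𝕜}
    {R : Matrix ι ι 𝕜} (hx : IsIIDWithSecondMoment P x R) :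
    ∀ᵐ ω ∂P, Tendsto (empiricalSecondMoment fun m => x m ω) atTop (𝓝 R) := by
  have hentry (i j : ι) : ∀ᵐ ω ∂P, Tendsto
      (fun M : ℕ => (M : ℝ)⁻¹ • ∑ m ∈ Finset.range M, x m ω i * star (x m ω j)) atTop
      (𝓝 (R i j)) := by
    have hmeas : Measurable fun y : ι → 𝕜 => y i * star (y j) := by fun_prop
    rw [← hx.integral_mul_star i j]
    exact strong_law_ae (fun m ω => x m ω i * star (x m ω j))
      ((hx.memLp_two i).integrable_mul (hx.memLp_two j).star)
      (fun m m' hm => (hx.indep hm).comp hmeas hmeas) fun m => (hx.identDistrib m).comp hmeas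
  filter_upwards [ae_all_iff.2 fun i => ae_all_iff.2 (hentry i)] with ω hω
  refine tendsto_pi_nhds.2 fun i => tendsto_pi_nhds.2 fun j => ?_
  simpa only [empiricalSecondMoment, Matrix.smul_apply, Matrix.sum_apply, Matrix.vecMulVec_apply,
    Pi.star_apply] using hω i j

theorem isIIDWithSecondMoment_diagonal [Finite ι] [DecidableEq ι] {z : ι → ℕ → Ω → 𝕜} {σ : ι → 𝕜}
    (hindep : iIndepFun (fun p : ι × ℕ => z p.1 p.2) P)
    (hident : ∀ i m, IdentDistrib (z i m) (z i 0) P P) (hmem : ∀ i, MemLp (z i 0) 2 P)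
    (hmean : ∀ i, ∫ ω, z i 0 ω ∂P = 0) (hsecond : ∀ i, ∫ ω, z i 0 ω * star (z i 0 ω) ∂P = σ i) :
    IsIIDWithSecondMoment P (fun m ω i => z i m ω) (Matrix.diagonal σ) where
  memLp_two := hmem
  indep m m' hm := by
    have := Fintype.ofFinite ι
    have hdisjoint : Disjoint (Finset.univ ×ˢ {m}) ((Finset.univ : Finset ι) ×ˢ {m'}) :=
      Finset.disjoint_product.2 (Or.inr (by simpa using hm))
    have hblocks := hindep.indepFun_finset₀ _ _ hdisjoint fun p =>
      (hident p.1 p.2).aemeasurable_fst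
    have hread (k : ℕ) : Measurable fun (y : ↥((Finset.univ : Finset ι) ×ˢ {k}) → 𝕜) (i : ι) =>
        y ⟨(i, k), by simp⟩ :=
      measurable_pi_lambda _ fun i => measurable_pi_apply _
    exact hblocks.comp (hread m) (hread m')
  identDistrib m := by
    have hcolumn (k : ℕ) : iIndepFun (fun i => z i k) P :=
      hindep.precomp (g := fun i => (i, k)) (Prod.mk_left_injective k)
    exact IdentDistrib.pi (fun i => hident i m) (hcolumn m) (hcolumn 0)
  integral_mul_star i j := by
    obtain rfl | hij := eq_or_ne i j
    · rw [hsecond, Matrix.diagonal_apply_eq]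
    · have hentries : IndepFun (z i 0) (fun ω => star (z j 0 ω)) P :=
        (hindep.indepFun (i := (i, 0)) (j := (j, 0)) (by simpa using hij)).comp measurable_id
          continuous_star.measurable
      rw [Matrix.diagonal_apply_ne _ hij, hentries.integral_fun_mul_eq_mul_integral
        (hmem i).aestronglyMeasurable (hmem j).star.aestronglyMeasurable, hmean, zero_mul]

end StrongLaw

section ComplexGaussian

variable (v : ℝ≥0)

instance isProbabilityMeasure_complexGaussian : IsProbabilityMeasure (complexGaussian v) :=
  Measure.isProbabilityMeasure_map Complex.measurableEquivRealProd.symm.measurable.aemeasurable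

theorem hasLaw_re_complexGaussian :
    HasLaw Complex.re (gaussianReal 0 (v / 2)) (complexGaussian v) where
  map_eq := by
    rw [complexGaussian, Measure.map_map Complex.measurable_re
      Complex.measurableEquivRealProd.symm.measurable]
    exact measurePreserving_fst.map_eq

theorem hasLaw_im_complexGaussian :
    HasLaw Complex.im (gaussianReal 0 (v / 2)) (complexGaussian v) where
  map_eq := by
    rw [complexGaussian, Measure.map_map Complex.measurable_im
      Complex.measurableEquivRealProd.symm.measurable]
    exact measurePreserving_snd.map_eq

theorem integral_sq_of_hasLaw_gaussianReal {Ω : Type*} {mΩ : MeasurableSpace Ω} {P : Measure Ω}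
    {X : Ω → ℝ} (hX : HasLaw X (gaussianReal 0 v) P) : ∫ ω, X ω ^ 2 ∂P = v := by
  have hmean : ∫ ω, X ω ∂P = 0 := by rw [hX.integral_eq, integral_id_gaussianReal]
  rw [← variance_of_integral_eq_zero hX.aemeasurable hmean, hX.variance_eq,
    variance_id_gaussianReal]

theorem memLp_two_id_complexGaussian : MemLp id 2 (complexGaussian v) :=
  memLp_re_im_iff.1 ⟨(hasLaw_re_complexGaussian v).hasGaussianLaw.memLp_two,
    (hasLaw_im_complexGaussian v).hasGaussianLaw.memLp_two⟩

theorem integral_id_complexGaussian : ∫ z, z ∂complexGaussian v = 0 := by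
  have hint : Integrable (fun z : ℂ => z) (complexGaussian v) :=
    (memLp_two_id_complexGaussian v).integrable one_le_two
  rw [← integral_re_add_im hint]
  simp [(hasLaw_re_complexGaussian v).integral_eq, (hasLaw_im_complexGaussian v).integral_eq]

theorem integral_mul_star_complexGaussian :
    ∫ z, z * star z ∂complexGaussian v = ((v : ℝ) : ℂ) := by
  have hsq (z : ℂ) : z * star z = ((z.re ^ 2 + z.im ^ 2 : ℝ) : ℂ) := by
    rw [Complex.star_def, Complex.mul_conj, Complex.normSq_apply]
    ring_nf
  simp_rw [hsq]
  rw [integral_complex_ofReal, integral_add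
    (hasLaw_re_complexGaussian v).hasGaussianLaw.memLp_two.integrable_sq
    (hasLaw_im_complexGaussian v).hasGaussianLaw.memLp_two.integrable_sq,
    integral_sq_of_hasLaw_gaussianReal _ (hasLaw_re_complexGaussian v),
    integral_sq_of_hasLaw_gaussianReal _ (hasLaw_im_complexGaussian v), NNReal.coe_div,
    NNReal.coe_ofNat, add_halves]

theorem isIIDWithSecondMoment_of_hasLaw_complexGaussian {Ω ι : Type*} [MeasurableSpace Ω]
    {P : Measure Ω} [Finite ι] [DecidableEq ι] {z : ι → ℕ → Ω → ℂ} {σ : ι → ℝ≥0}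
    (hlaw : ∀ i m, HasLaw (z i m) (complexGaussian (σ i)) P)
    (hindep : iIndepFun (fun p : ι × ℕ => z p.1 p.2) P) :
    IsIIDWithSecondMoment P (fun m ω i => z i m ω)
      (Matrix.diagonal fun i => ((σ i : ℝ) : ℂ)) := by
  have hident (i : ι) (m : ℕ) : IdentDistrib (z i m) id P (complexGaussian (σ i)) :=
    (hlaw i m).identDistrib HasLaw.id
  refine isIIDWithSecondMoment_diagonal hindep (fun i m => (hident i m).trans (hident i 0).symm)
    (fun i => (hident i 0).memLp_iff.2 (memLp_two_id_complexGaussian (σ i))) (fun i => ?_)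
    fun i => ?_
  · rw [(hlaw i 0).integral_eq, integral_id_complexGaussian]
  · rw [← integral_mul_star_complexGaussian]
    exact (hlaw i 0).integral_comp (f := fun z => z * star z) (by fun_prop)

end ComplexGaussian

section SampleCovariance

theorem empiricalSecondMoment_mulVec {𝕜 m n : Type*} [RCLike 𝕜] [Fintype n] (A : Matrix m n 𝕜)
    (x : ℕ → n → 𝕜) (M : ℕ) :
    empiricalSecondMoment (fun k => A *ᵥ x k) M = A * empiricalSecondMoment x M * Aᴴ := by
  simp only [empiricalSecondMoment, Matrix.mul_smul, Matrix.smul_mul, Matrix.mul_sum,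
    Matrix.sum_mul, Matrix.mul_vecMulVec, Matrix.vecMulVec_mul, Matrix.star_mulVec]

theorem sampleCov_of {L : ℕ} (x : ℕ → Fin L → ℂ) (M : ℕ) :
    sampleCov (Matrix.of fun l (m : Fin M) => x m l) = empiricalSecondMoment x M := by
  ext l l'
  simp [sampleCov, empiricalSecondMoment, Matrix.mul_apply, Matrix.sum_apply,
    Matrix.vecMulVec_apply, Finset.sum_range]

variable {L Nd Q : ℕ}

/-- The channel gains and the noise at antenna `m`, stacked into one vector. -/
def antennaVector (h : Fin Nd → ℕ → ℂ) (w : Fin L → ℕ → ℂ) (m : ℕ) : Fin Nd ⊕ Fin L → ℂ :=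
  Sum.elim (fun n => h n m) (fun l => w l m)

/-- The second-moment matrix of the stacked vector: the gains have unit variance, the noise has
variance `v`, and all entries are uncorrelated. -/
noncomputable def antennaCov (Nd L : ℕ) (v : ℝ≥0) : Matrix (Fin Nd ⊕ Fin L) (Fin Nd ⊕ Fin L) ℂ :=
  Matrix.fromBlocks 1 0 0 (((v : ℝ) : ℂ) • 1)

/-- The matrix that sends the channel gains at one antenna to the amplitudes
`a_n^{(q)} g_n h_n` of the signature sequences. -/
def activityMatrix (g : Fin Nd → ℝ) (a : Fin Nd → Fin Q → ℝ) :
    Matrix (Fin Nd × Fin Q) (Fin Nd) ℂ :=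
  Matrix.of fun i n => if n = i.1 then (a i.1 i.2 : ℂ) * g i.1 else 0

/-- The matrix that sends the stacked gains and noise at one antenna to the received signal. -/
def receiverMatrix (S : Matrix (Fin L) (Fin Nd × Fin Q) ℂ) (g : Fin Nd → ℝ)
    (a : Fin Nd → Fin Q → ℝ) : Matrix (Fin L) (Fin Nd ⊕ Fin L) ℂ :=
  Matrix.fromCols (S * activityMatrix g a) 1

variable {a : Fin Nd → Fin Q → ℝ}

theorem receivedSignal_eq_receiverMatrix_mulVec (S : Matrix (Fin L) (Fin Nd × Fin Q) ℂ)
    (g : Fin Nd → ℝ) (a : Fin Nd → Fin Q → ℝ) (h : Fin Nd → ℕ → ℂ) (w : Fin L → ℕ → ℂ) (M : ℕ) :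
    receivedSignal S g a h w M =
      Matrix.of fun l (m : Fin M) => (receiverMatrix S g a *ᵥ antennaVector h w m) l := by
  ext l m
  simp only [receivedSignal, receiverMatrix, antennaVector, Matrix.of_apply,
    Matrix.fromCols_mulVec_sumElim, Matrix.one_mulVec, Pi.add_apply, ← Matrix.mulVec_mulVec]
  congr 1
  simp only [Matrix.mulVec, dotProduct, activityMatrix, Matrix.of_apply, Fintype.sum_prod_type,
    ite_mul, zero_mul, Finset.sum_ite_eq', Finset.mem_univ, if_true]
  exact Finset.sum_congr rfl fun n _ => Finset.sum_congr rfl fun q _ => by ring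

theorem sampleCov_receivedSignal (S : Matrix (Fin L) (Fin Nd × Fin Q) ℂ) (g : Fin Nd → ℝ)
    (a : Fin Nd → Fin Q → ℝ) (h : Fin Nd → ℕ → ℂ) (w : Fin L → ℕ → ℂ) (M : ℕ) :
    sampleCov (receivedSignal S g a h w M) = receiverMatrix S g a *
      empiricalSecondMoment (antennaVector h w) M * (receiverMatrix S g a)ᴴ := by
  rw [receivedSignal_eq_receiverMatrix_mulVec, ← empiricalSecondMoment_mulVec, ← sampleCov_of]

theorem IsIndicator.mul_eq_zero (ha : IsIndicator a) {n : Fin Nd} {q q' : Fin Q} (hq : q ≠ q') :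
    a n q * a n q' = 0 := by
  by_contra hne
  have h1 : a n q = 1 := (ha.1 n q).resolve_left (left_ne_zero_of_mul hne)
  have h2 : a n q' = 1 := (ha.1 n q').resolve_left (right_ne_zero_of_mul hne)
  have hle : ∑ r ∈ {q, q'}, |a n r| ≤ ∑ r, |a n r| :=
    Finset.sum_le_sum_of_subset_of_nonneg (Finset.subset_univ _) fun _ _ _ => abs_nonneg _
  rw [Finset.sum_pair hq, h1, h2] at hle
  rcases ha.2 n with h | h <;> rw [h] at hle <;> norm_num at hle

theorem activityMatrix_mul_conjTranspose (g : Fin Nd → ℝ) (ha : IsIndicator a) :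
    activityMatrix g a * (activityMatrix g a)ᴴ =
      Matrix.diagonal fun i => (trueGamma g a i : ℂ) := by
  ext ⟨n, q⟩ ⟨n', q'⟩
  simp only [Matrix.mul_apply, activityMatrix, Matrix.of_apply, Matrix.conjTranspose_apply,
    ite_mul, zero_mul, Finset.sum_ite_eq', Finset.mem_univ, if_true, Matrix.diagonal_apply,
    Prod.mk.injEq, trueGamma]
  obtain rfl | hn := eq_or_ne n n'
  · obtain rfl | hq := eq_or_ne q q'
    · obtain h | h := ha.1 n q <;> simp [h, sq]
    · have hzero : (a n q : ℂ) * a n q' = 0 := by exact_mod_cast ha.mul_eq_zero hq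
      simp [hq, mul_mul_mul_comm, hzero]
  · simp [hn]

theorem receiverMatrix_mul_antennaCov_mul_conjTranspose (S : Matrix (Fin L) (Fin Nd × Fin Q) ℂ)
    (v : ℝ≥0) (g : Fin Nd → ℝ) (ha : IsIndicator a) :
    receiverMatrix S g a * antennaCov Nd L v * (receiverMatrix S g a)ᴴ =
      modelCov S v (trueGamma g a) := by
  rw [receiverMatrix, antennaCov, Matrix.fromCols_mul_fromBlocks,
    Matrix.conjTranspose_fromCols_eq_fromRows_conjTranspose, Matrix.fromCols_mul_fromRows,
    modelCov, ← activityMatrix_mul_conjTranspose g ha]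
  simp only [Matrix.mul_zero, Matrix.mul_one, Matrix.one_mul, add_zero, zero_add,
    Matrix.conjTranspose_mul, Matrix.conjTranspose_one, Matrix.mul_assoc]

theorem tendsto_sampleCov (S : Matrix (Fin L) (Fin Nd × Fin Q) ℂ) (v : ℝ≥0) (g : Fin Nd → ℝ)
    (ha : IsIndicator a) {h : Fin Nd → ℕ → ℂ} {w : Fin L → ℕ → ℂ}
    (hlim : Tendsto (empiricalSecondMoment (antennaVector h w)) atTop (𝓝 (antennaCov Nd L v))) :
    Tendsto (fun M => sampleCov (receivedSignal S g a h w M)) atTop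
      (𝓝 (modelCov S v (trueGamma g a))) := by
  simp only [sampleCov_receivedSignal,
    ← receiverMatrix_mul_antennaCov_mul_conjTranspose S v g ha]
  exact (((continuous_const.matrix_mul continuous_id).matrix_mul continuous_const).tendsto _).comp
    hlim

end SampleCovariance

section TrueParameter

variable {L Nd Q : ℕ} {a : Fin Nd → Fin Q → ℝ}

theorem trueGamma_nonneg (g : Fin Nd → ℝ) (ha : IsIndicator a) (i : Fin Nd × Fin Q) :
    0 ≤ trueGamma g a i := by
  unfold trueGamma
  rcases ha.1 i.1 i.2 with h | h <;> rw [h] <;> positivity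

theorem card_filter_eq_one_le_ncard_activeDevices (ha : IsIndicator a) :
    (Finset.univ.filter fun i : Fin Nd × Fin Q => a i.1 i.2 = 1).card ≤
      (activeDevices a).ncard := by
  classical
  rw [Set.ncard_eq_toFinset_card']
  refine Finset.card_le_card_of_injOn Prod.fst (fun i hi => ?_) fun i hi j hj hij => ?_
  · have hone : a i.1 i.2 = 1 := by simpa using hi
    have hle := Finset.single_le_sum (f := fun q => |a i.1 q|) (fun q _ => abs_nonneg _)
      (Finset.mem_univ i.2)
    rw [Finset.mem_coe, Set.mem_toFinset]
    refine (ha.2 i.1).resolve_left fun hzero => ?_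
    rw [hzero, hone] at hle
    norm_num at hle
  · obtain ⟨n, q⟩ := i
    obtain ⟨n', q'⟩ := j
    obtain rfl : n = n' := hij
    have hq : a n q = 1 := by simpa using hi
    have hq' : a n q' = 1 := by simpa using hj
    by_contra hne
    have hzero := ha.mul_eq_zero (n := n) (q := q) (q' := q') fun h => hne (by rw [h])
    norm_num [hq, hq'] at hzero

theorem eq_trueGamma_of_modelCov_eq {S : Matrix (Fin L) (Fin Nd × Fin Q) ℂ}
    (hS : ∀ i, S.col i ≠ 0) {v : ℝ≥0} {g : Fin Nd → ℝ} (ha : IsIndicator a)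
    (hμ : (activeDevices a).ncard * coherence S ^ 2 < 1) {γ : Fin Nd × Fin Q → ℝ}
    (hγ : ∀ i, 0 ≤ γ i) (h : modelCov S v γ = modelCov S v (trueGamma g a)) :
    γ = trueGamma g a := by
  refine sub_eq_zero.1 (eq_zero_of_mul_diagonal_mul_conjTranspose_eq_zero hS
    (T := Finset.univ.filter fun i => a i.1 i.2 = 1) (lt_of_le_of_lt ?_ hμ) (fun i hi => ?_) ?_)
  · gcongr
    exact card_filter_eq_one_le_ncard_activeDevices ha
  · have hzero : a i.1 i.2 = 0 := (ha.1 i.1 i.2).resolve_right (by simpa using hi)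
    simpa [trueGamma, hzero] using hγ i
  · simp only [Pi.sub_apply, Complex.ofReal_sub, ← Matrix.diagonal_sub]
    rw [Matrix.mul_sub, Matrix.sub_mul, sub_eq_zero]
    exact add_right_cancel h

theorem mul_sq_lt_one_of_lt_one_div_sqrt {k r μ : ℝ} (hkr : k ≤ r) (hμ₀ : 0 ≤ μ)
    (hμ : μ < 1 / √r) : k * μ ^ 2 < 1 := by
  have hr : 0 < r := Real.sqrt_pos.1 (one_div_pos.1 (hμ₀.trans_lt hμ))
  rw [one_div, ← Real.sqrt_inv, Real.lt_sqrt hμ₀, ← one_div, lt_div_iff₀' hr] at hμ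
  exact (mul_le_mul_of_nonneg_right hkr (sq_nonneg μ)).trans_lt hμ

end TrueParameter

theorem IsChannelModel.isIIDWithSecondMoment {L Nd : ℕ} {v : ℝ≥0} {Ω : Type*} [MeasurableSpace Ω]
    {P : Measure Ω} {h : Fin Nd → ℕ → Ω → ℂ} {w : Fin L → ℕ → Ω → ℂ}
    (hmodel : IsChannelModel P v h w) :
    IsIIDWithSecondMoment P
      (fun m ω => antennaVector (fun n m => h n m ω) (fun l m => w l m ω) m)
      (antennaCov Nd L v) := by
  have hindep : iIndepFun (fun p : (Fin Nd ⊕ Fin L) × ℕ => Sum.elim h w p.1 p.2) P := by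
    convert hmodel.indep.precomp (Equiv.sumProdDistrib (Fin Nd) (Fin L) ℕ).injective using 1
    funext ⟨k, m⟩
    cases k <;> rfl
  have hlaw : ∀ k m, HasLaw (Sum.elim h w k m)
      (complexGaussian (Sum.elim (fun _ => 1) (fun _ => v) k)) P :=
    Sum.rec hmodel.law_channel hmodel.law_noise
  convert isIIDWithSecondMoment_of_hasLaw_complexGaussian hlaw hindep using 1
  · funext m ω k
    cases k <;> rfl
  · rw [antennaCov, Matrix.smul_one_eq_diagonal, ← Matrix.diagonal_one, Matrix.fromBlocks_diagonal]
    congr 1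
    funext k
    cases k <;> simp

theorem exists_measurableSet_lt_measureReal_of_ae {Ω : Type*} [MeasurableSpace Ω] {P : Measure Ω}
    [IsProbabilityMeasure P] {p : Ω → Prop} (hp : ∀ᵐ ω ∂P, p ω) {ε : ℝ} (hε : 0 < ε) :
    ∃ E : Set Ω, MeasurableSet E ∧ 1 - ε < P.real E ∧ ∀ ω ∈ E, p ω := by
  obtain ⟨E, hE_ae, hE, hEp⟩ := hp.exists_measurable_mem
  refine ⟨E, hE, ?_, hEp⟩
  rw [measureReal_def, (mem_ae_iff_prob_eq_one hE).1 hE_ae, ENNReal.toReal_one]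
  exact sub_lt_self 1 hε

end GrantFree

theorem mainTheorem1_general {L Nd Q : ℕ} {S : Matrix (Fin L) (Fin Nd × Fin Q) ℂ}
    (hS : ∀ i, S.col i ≠ 0) (g : Fin Nd → ℝ) {v : ℝ≥0} (hv : 0 < v)
    {Ω : Type*} [MeasurableSpace Ω] {P : Measure Ω}
    {h : Fin Nd → ℕ → Ω → ℂ} {w : Fin L → ℕ → Ω → ℂ}
    (hmoment : GrantFree.IsIIDWithSecondMoment P
      (fun m ω => GrantFree.antennaVector (fun n m => h n m ω) (fun l m => w l m ω) m)
      (GrantFree.antennaCov Nd L v)) :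
    ∀ᵐ ω ∂P, ∀ a : Fin Nd → Fin Q → ℝ, GrantFree.IsIndicator a →
      (GrantFree.activeDevices a).ncard * GrantFree.coherence S ^ 2 < 1 →
      (∀ M, 1 ≤ M → ∃ γ, GrantFree.IsMLEstimate S v (GrantFree.sampleCov
          (GrantFree.receivedSignal S g a (fun n m => h n m ω) (fun l m => w l m ω) M)) γ) ∧
        ∀ γhat : ℕ → Fin Nd × Fin Q → ℝ,
          (∀ M, 1 ≤ M → GrantFree.IsMLEstimate S v (GrantFree.sampleCov
            (GrantFree.receivedSignal S g a (fun n m => h n m ω) (fun l m => w l m ω) M))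
              (γhat M)) →
            Tendsto γhat atTop (𝓝 (GrantFree.trueGamma g a)) := by
  filter_upwards [hmoment.ae_tendsto_empiricalSecondMoment] with ω hω a ha hμ
  refine ⟨fun M _ => GrantFree.exists_isMLEstimate hS hv (GrantFree.sampleCov_posSemidef _),
    fun γhat hML => ?_⟩
  exact GrantFree.tendsto_of_isMLEstimate hS hv
    (Eventually.of_forall fun M => GrantFree.sampleCov_posSemidef _)
    (GrantFree.trueGamma_nonneg g ha) (GrantFree.tendsto_sampleCov S v g ha hω)
    (fun γ hγ => GrantFree.eq_trueGamma_of_modelCov_eq hS ha hμ hγ)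
    (eventually_atTop.2 ⟨1, hML⟩)

theorem mainTheorem1 {L Nd Q K δ : ℕ} (hδ : 0 < δ)
    (S : Matrix (Fin L) (Fin Nd × Fin Q) ℂ) (hS : ∀ i, S.col i ≠ 0)
    (hμ : GrantFree.coherence S < 1 / Real.sqrt ((K : ℝ) + (δ : ℝ) - 1))
    (g : Fin Nd → ℝ) (hg : ∀ n, 0 < g n) (v : ℝ≥0) (hv : 0 < v)
    {Ω : Type*} [MeasurableSpace Ω] (P : Measure Ω) [IsProbabilityMeasure P]
    (h : Fin Nd → ℕ → Ω → ℂ) (w : Fin L → ℕ → Ω → ℂ)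
    (hmodel : GrantFree.IsChannelModel P v h w) :
    ∃ E : Set Ω, MeasurableSet E ∧ 1 - (2 : ℝ) ^ (-(δ : ℤ)) < P.real E ∧
      ∀ ω ∈ E, ∀ a : Fin Nd → Fin Q → ℝ, GrantFree.IsIndicator a →
        (GrantFree.activeDevices a).ncard = K →
        (∀ M, 1 ≤ M → ∃ γ, GrantFree.IsMLEstimate S v (GrantFree.sampleCov (GrantFree.receivedSignal S g a
            (fun n m => h n m ω) (fun l m => w l m ω) M)) γ) ∧
          ∀ γhat : ℕ → Fin Nd × Fin Q → ℝ,
            (∀ M, 1 ≤ M → GrantFree.IsMLEstimate S v (GrantFree.sampleCov (GrantFree.receivedSignal S g a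
            (fun n m => h n m ω) (fun l m => w l m ω) M)) (γhat M)) →
              Tendsto γhat atTop (𝓝 (GrantFree.trueGamma g a)) := by
  have hK : (K : ℝ) * GrantFree.coherence S ^ 2 < 1 :=
    GrantFree.mul_sq_lt_one_of_lt_one_div_sqrt
      (by linarith [show (1 : ℝ) ≤ δ from mod_cast hδ]) (GrantFree.coherence_nonneg S) hμ
  obtain ⟨E, hE, hPE, hgood⟩ := GrantFree.exists_measurableSet_lt_measureReal_of_ae
    (mainTheorem1_general hS g hv hmodel.isIIDWithSecondMoment)
    (show (0 : ℝ) < 2 ^ (-(δ : ℤ)) by positivity)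
  exact ⟨E, hE, hPE, fun ω hω a ha hcard => hgood ω hω a ha (hcard ▸ hK)⟩
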